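/- Let $\mathbb F$ be a field, let $d\ge 1$ be an integer, let $V$ be a vector space over $\mathbb F$ of dimension $d+1$, and let $0\neq q\in\mathbb F$ with $q^4\neq 1$. A square matrix is *irreducible tridiagonal* if its nonzero entries lie on the diagonal, subdiagonal and superdiagonal, and all sub- and superdiagonal entries are nonzero. A *Leonard pair* on $V$ is an ordered pair $A,A^*\in\mathrm{End}(V)$ (here $A^*$ is just a second map, not an adjoint) such that in some basis of $V$ the matrix of $A$ is irreducible tridiagonal and that of $A^*$ is diagonal, and in some basis the matrix of $A^*$ is irreducible tridiagonal and that of $A$ is diagonal. A *Leonard system* on $V$ is a sequence $\Phi=(A;\{E_i\}_{i=0}^d;A^*;\{E^*_i\}_{i=0}^d)$ where $A,A^*$ is a Leonard pair on $V$, both maps are multiplicity-free (diagonalizable with one-dimensional eigenspaces), $E_0,\dots,E_d$ are the primitive idempotents of $A$ (the projections onto its eigenspaces) in an order such that with respect to a basis $v_i\in E_iV$ $(0\le i\le d)$ the matrix of $A^*$ is irreducible tridiagonal (and that of $A$ diagonal), and likewise $E^*_0,\dots,E^*_d$ for $A^*$ with the roles of $A,A^*$ exchanged. Let $\theta_i$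 (resp. $\theta^*_i$) be the eigenvalue of $A$ (resp. $A^*$) corresponding to $E_i$ (resp. $E^*_i$). For $0\neq u\in E^*_0V$ the vectors $(A-\theta_0)(A-\theta_1)\cdots(A-\theta_{i-1})u$ $(0\le i\le d)$ form a basis of $V$, with respect to which $A$ is lower bidiagonal with diagonal $\theta_0,\dots,\theta_d$ and subdiagonal entries $1$, and $A^*$ is upper bidiagonal with diagonal $\theta^*_0,\dots,\theta^*_d$; its superdiagonal entries $\varphi_1,\dots,\varphi_d$ form the *first split sequence* of $\Phi$. The *second split sequence* $\phi_1,\dots,\phi_d$ of $\Phi$ is the first split sequence of $(A;\{E_{d-i}\}_{i=0}^d;A^*;\{E^*_i\}_{i=0}^d)$. We say that $\Phi$ has *$q$-Racah type with Huang data $(a,b,c,d)$*, where $a,b,c\in\mathbb F$ are nonzero, if $$\theta_i=aq^{2i-d}+a^{-1}q^{d-2i},\qquad \theta^*_i=bq^{2i-d}+b^{-1}q^{d-2i}\qquad(0\le i\le d)$$ and, for $1\le i\le d$, $$\varphi_i=a^{-1}b^{-1}q^{d+1}(q^i-q^{-i})(q^{i-d-1}-q^{d-i+1})(q^{-i}-abc\,q^{i-d-1})(q^{-i}-abc^{-1}q^{i-d-1}),$$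 $$\phi_i=ab^{-1}q^{d+1}(q^i-q^{-i})(q^{i-d-1}-q^{d-i+1})(q^{-i}-a^{-1}bc\,q^{i-d-1})(q^{-i}-a^{-1}bc^{-1}q^{i-d-1}).$$ A *Boltzmann pair* for $A,A^*$ is an ordered pair $W,W^*$ of invertible elements of $\mathrm{End}(V)$ such that $W$ lies in the subalgebra generated by $A$, $W^*$ lies in the subalgebra generated by $A^*$, and $WA^*W^{-1}=(W^*)^{-1}AW^*$. **Lemma.** Let $\Phi=(A;\{E_i\}_{i=0}^d;A^*;\{E^*_i\}_{i=0}^d)$ be a Leonard system on $V$ that has $q$-Racah type with Huang data $(a,a,c,d)$. Let $\tau_i=(-1)^ia^{-i}q^{i(d-i)}$ for $0\le i\le d$, let $0\neq f\in\mathbb F$, and put $$W=f\sum_{i=0}^d\tau_iE_i,\qquad W^*=f\sum_{i=0}^d\tau_iE^*_i.$$ If $W,W^*$ is a Boltzmann pair for $A,A^*$, then $c\in\{a,a^{-1}\}$. -/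

import Mathlib

/-- A square matrix is irreducible tridiagonal: every nonzero entry lies on the diagonal, the
subdiagonal or the superdiagonal, and all entries on the sub- and superdiagonal are nonzero. -/
def IsIrredTridiagonal {F : Type*} [Field F] {d : ℕ}
    (M : Matrix (Fin (d + 1)) (Fin (d + 1)) F) : Prop :=
  (∀ i j : Fin (d + 1), M i j ≠ 0 →
      (i : ℕ) = j ∨ (i : ℕ) = (j : ℕ) + 1 ∨ (j : ℕ) = (i : ℕ) + 1) ∧
    ∀ i j : Fin (d + 1), (i : ℕ) = (j : ℕ) + 1 → M i j ≠ 0 ∧ M j i ≠ 0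

/-- With respect to the basis `v`, the matrix representing `X` is irreducible tridiagonal and the
matrix representing `Y` is diagonal. -/
def TridiagonalDiagonal {F V : Type*} [Field F] [AddCommGroup V] [Module F V] {d : ℕ}
    (v : Module.Basis (Fin (d + 1)) F V) (X Y : Module.End F V) : Prop :=
  IsIrredTridiagonal (LinearMap.toMatrix v v X) ∧ (LinearMap.toMatrix v v Y).IsDiag

/-- `A, As` is a Leonard pair on the vector space `V` of dimension `d + 1`. -/
def IsLeonardPair {F V : Type*} [Field F] [AddCommGroup V] [Module F V] (d : ℕ)
    (A As : Module.End F V) : Prop :=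
  (∃ v : Module.Basis (Fin (d + 1)) F V, TridiagonalDiagonal v A As) ∧
    ∃ v : Module.Basis (Fin (d + 1)) F V, TridiagonalDiagonal v As A

/-- `A` is multiplicity-free (it is diagonalizable and each eigenspace has dimension one) and
`E 0, …, E d` is an ordering of its primitive idempotents: `E i` is the projection onto the `i`-th
eigenspace along the sum of the other ones. -/
def IsPrimitiveIdempotents {F V : Type*} [Field F] [AddCommGroup V] [Module F V] {d : ℕ}
    (A : Module.End F V) (E : Fin (d + 1) → Module.End F V) : Prop :=
  ∃ θ : Fin (d + 1) → F, Function.Injective θ ∧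
    (∀ i, Module.finrank F (Module.End.eigenspace A (θ i)) = 1) ∧
    (⨆ i, Module.End.eigenspace A (θ i)) = ⊤ ∧
    ∀ i, (∀ v ∈ Module.End.eigenspace A (θ i), E i v = v) ∧
      ∀ j, j ≠ i → ∀ v ∈ Module.End.eigenspace A (θ j), E i v = 0

/-- `E 0, …, E d` is a standard ordering of the primitive idempotents of `A`, for the Leonard pair
`A, As`: a basis of vectors `v i ∈ E i V` makes `As` irreducible tridiagonal and `A` diagonal.
(Each `E i V` is a line, so that the choice of the `v i` does not matter.) -/
def IsStandardOrdering {F V : Type*} [Field F] [AddCommGroup V] [Module F V] {d : ℕ}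
    (A As : Module.End F V) (E : Fin (d + 1) → Module.End F V) : Prop :=
  IsPrimitiveIdempotents A E ∧
    ∃ v : Module.Basis (Fin (d + 1)) F V,
      (∀ i, v i ∈ LinearMap.range (E i)) ∧ TridiagonalDiagonal v As A

/-- `(A; E_0, …, E_d; As; Es_0, …, Es_d)` is a Leonard system on `V`. -/
structure IsLeonardSystem {F V : Type*} [Field F] [AddCommGroup V] [Module F V] {d : ℕ}
    (A : Module.End F V) (E : Fin (d + 1) → Module.End F V)
    (As : Module.End F V) (Es : Fin (d + 1) → Module.End F V) : Prop where
  leonardPair : IsLeonardPair d A As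
  standard : IsStandardOrdering A As E
  dualStandard : IsStandardOrdering As A Es

/-- `θ i` is the eigenvalue of `A` corresponding to the primitive idempotent `E i`. -/
def IsEigenvalueSequence {F V : Type*} [Field F] [AddCommGroup V] [Module F V] {d : ℕ}
    (A : Module.End F V) (E : Fin (d + 1) → Module.End F V) (θ : Fin (d + 1) → F) : Prop :=
  ∀ i, LinearMap.range (E i) = Module.End.eigenspace A (θ i)

/-- The vector `(A - θ_0)(A - θ_1) ⋯ (A - θ_{i-1}) u`. -/
noncomputable def splitVector {F V : Type*} [Field F] [AddCommGroup V] [Module F V] {d : ℕ}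
    (A : Module.End F V) (θ : Fin (d + 1) → F) (u : V) (i : Fin (d + 1)) : V :=
  Polynomial.aeval A
    (∏ h ∈ Finset.univ.filter (fun h : Fin (d + 1) => h < i),
      (Polynomial.X - Polynomial.C (θ h))) u

/-- `φ 1, …, φ d` is the first split sequence of the Leonard system with eigenvalue sequence `θ`
and dual eigenvalue sequence `θs`: with respect to a split basis `(A - θ_0) ⋯ (A - θ_{i-1}) u`,
where `0 ≠ u ∈ Es_0 V`, the matrix of `A` is lower bidiagonal with diagonal `θ` and
subdiagonal `1, …, 1`, and the matrix of `As` is upper bidiagonal with diagonal `θs` and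
superdiagonal `φ 1, …, φ d`. Only the values of `φ` at `1, …, d` matter. -/
def IsFirstSplitSequence {F V : Type*} [Field F] [AddCommGroup V] [Module F V] {d : ℕ}
    (A As : Module.End F V) (Es : Fin (d + 1) → Module.End F V)
    (θ θs : Fin (d + 1) → F) (φ : ℕ → F) : Prop :=
  ∃ u ∈ LinearMap.range (Es 0), u ≠ 0 ∧
    ∃ v : Module.Basis (Fin (d + 1)) F V, (∀ i, v i = splitVector A θ u i) ∧
      LinearMap.toMatrix v v A = Matrix.of (fun i j : Fin (d + 1) =>
        if i = j then θ i else if (i : ℕ) = (j : ℕ) + 1 then 1 else 0) ∧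
      LinearMap.toMatrix v v As = Matrix.of (fun i j : Fin (d + 1) =>
        if i = j then θs i else if (j : ℕ) = (i : ℕ) + 1 then φ (j : ℕ) else 0)

/-- `(θ; θs; φ; ϕ)` is the parameter array of the Leonard system `(A; E; As; Es)`. The second split
sequence `ϕ` is the first split sequence of the Leonard system obtained by reversing the ordering
of the primitive idempotents of `A`. -/
structure IsParameterArray {F V : Type*} [Field F] [AddCommGroup V] [Module F V] {d : ℕ}
    (A : Module.End F V) (E : Fin (d + 1) → Module.End F V)
    (As : Module.End F V) (Es : Fin (d + 1) → Module.End F V)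
    (θ θs : Fin (d + 1) → F) (φ ϕ : ℕ → F) : Prop where
  eigenvalues : IsEigenvalueSequence A E θ
  dualEigenvalues : IsEigenvalueSequence As Es θs
  firstSplit : IsFirstSplitSequence A As Es θ θs φ
  secondSplit : IsFirstSplitSequence A As Es (fun i => θ i.rev) θs ϕ

/-- The eigenvalue sequence `a q^(2i-d) + a⁻¹ q^(d-2i)` of `q`-Racah type. -/
def qRacahEigenvalue {F : Type*} [Field F] (d : ℕ) (q a : F) (i : Fin (d + 1)) : F :=
  a * q ^ (2 * (i : ℤ) - (d : ℤ)) + a⁻¹ * q ^ ((d : ℤ) - 2 * (i : ℤ))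

/-- The first split sequence of `q`-Racah type. -/
def qRacahFirstSplit {F : Type*} [Field F] (d : ℕ) (q a b c : F) (i : ℕ) : F :=
  a⁻¹ * b⁻¹ * q ^ (d + 1) * (q ^ (i : ℤ) - q ^ (-(i : ℤ))) *
    (q ^ ((i : ℤ) - d - 1) - q ^ ((d : ℤ) - i + 1)) *
    (q ^ (-(i : ℤ)) - a * b * c * q ^ ((i : ℤ) - d - 1)) *
    (q ^ (-(i : ℤ)) - a * b * c⁻¹ * q ^ ((i : ℤ) - d - 1))

/-- The second split sequence of `q`-Racah type. -/
def qRacahSecondSplit {F : Type*} [Field F] (d : ℕ) (q a b c : F) (i : ℕ) : F :=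
  a * b⁻¹ * q ^ (d + 1) * (q ^ (i : ℤ) - q ^ (-(i : ℤ))) *
    (q ^ ((i : ℤ) - d - 1) - q ^ ((d : ℤ) - i + 1)) *
    (q ^ (-(i : ℤ)) - a⁻¹ * b * c * q ^ ((i : ℤ) - d - 1)) *
    (q ^ (-(i : ℤ)) - a⁻¹ * b * c⁻¹ * q ^ ((i : ℤ) - d - 1))

/-- The Leonard system `(A; E; As; Es)` has `q`-Racah type with Huang data `(a, b, c, d)`. -/
def IsHuangData {F V : Type*} [Field F] [AddCommGroup V] [Module F V] {d : ℕ}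
    (q : F) (A : Module.End F V) (E : Fin (d + 1) → Module.End F V)
    (As : Module.End F V) (Es : Fin (d + 1) → Module.End F V) (a b c : F) : Prop :=
  a ≠ 0 ∧ b ≠ 0 ∧ c ≠ 0 ∧
    IsParameterArray A E As Es (qRacahEigenvalue d q a) (qRacahEigenvalue d q b)
      (qRacahFirstSplit d q a b c) (qRacahSecondSplit d q a b c)

/-- `W, Ws` is a Boltzmann pair for the Leonard pair `A, As`: `W` and `Ws` are invertible elements
of the subalgebras generated by `A` and by `As`, and `Ws W As = A Ws W`, that is,
`W As W⁻¹ = Ws⁻¹ A Ws`. -/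
structure IsBoltzmannPair {F V : Type*} [Field F] [AddCommGroup V] [Module F V]
    (A As W Ws : Module.End F V) : Prop where
  mem : W ∈ Algebra.adjoin F {A}
  isUnit : IsUnit W
  dualMem : Ws ∈ Algebra.adjoin F {As}
  dualIsUnit : IsUnit Ws
  intertwine : Ws * W * As = A * Ws * W

/-! In a split basis `A` is lower bidiagonal and, as the Huang data are (a, a, c, d), `As` is the
transpose of a lower bidiagonal matrix with the same diagonal θ and subdiagonal φ. Write W and Ws
there as N and the transpose of L. Both N and L are lower triangular with diagonal f τ_i, and
commuting with the bidiagonal matrix makes their other entries (weighted) divided differences of f τ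
at the nodes θ.

One scalar equation suffices: the (d, 0) entry of `Ws * W * As = A * Ws * W` (`bottom_left_entry`).
It involves only the diagonal of L, its last subdiagonal entry, which is φ_d times a first divided
difference, and the ratio N_{d-1,0} / N_{d,0}. For this τ that ratio has a closed form
(`qRacah_dividedDifference_succ`). The equation thus determines φ_d, and comparison with the q-Racah
formula gives c + c⁻¹ = a + a⁻¹ (`add_inv_eq_of_split_relation`). -/

/-! ### Polynomials in triangular matrices -/

lemma Matrix.mul_apply_of_lowerTriangular {F : Type*} [Field F] {n : ℕ}
    {M N : Matrix (Fin n) (Fin n) F}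
    (hM : ∀ i j, i < j → M i j = 0) (hN : ∀ i j, i < j → N i j = 0) :
    (∀ i j, i < j → (M * N) i j = 0) ∧ ∀ i, (M * N) i i = M i i * N i i := by
  refine ⟨fun i j hij => ?_, fun i => ?_⟩
  · rw [Matrix.mul_apply]
    refine Finset.sum_eq_zero fun k _ => ?_
    rcases lt_or_ge i k with h | h
    · rw [hM i k h, zero_mul]
    · rw [hN k j (h.trans_lt hij), mul_zero]
  · rw [Matrix.mul_apply]
    refine Finset.sum_eq_single i (fun k _ hk => ?_) (by simp)
    rcases lt_or_gt_of_ne hk with h | h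
    · rw [hN k i h, mul_zero]
    · rw [hM i k h, zero_mul]

lemma Matrix.aeval_apply_of_lowerTriangular {F : Type*} [Field F] {n : ℕ}
    {M : Matrix (Fin n) (Fin n) F} (hM : ∀ i j, i < j → M i j = 0) (P : Polynomial F) :
    (∀ i j, i < j → (Polynomial.aeval M P) i j = 0) ∧
      ∀ i, (Polynomial.aeval M P) i i = P.eval (M i i) := by
  induction P using Polynomial.induction_on with
  | C a =>
    refine ⟨fun i j hij => ?_, fun i => ?_⟩
    · simp [Matrix.algebraMap_matrix_apply, hij.ne]
    · simp [Matrix.algebraMap_matrix_apply]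
  | add p q hp hq =>
    refine ⟨fun i j hij => ?_, fun i => ?_⟩
    · simp [hp.1 i j hij, hq.1 i j hij]
    · simp [hp.2 i, hq.2 i]
  | monomial k a ih =>
    have h := Matrix.mul_apply_of_lowerTriangular ih.1 hM
    have e : Polynomial.aeval M (Polynomial.C a * Polynomial.X ^ (k + 1)) =
        Polynomial.aeval M (Polynomial.C a * Polynomial.X ^ k) * M := by
      simp [pow_succ, mul_assoc]
    rw [e]
    refine ⟨h.1, fun i => ?_⟩
    rw [h.2, ih.2]
    simp [pow_succ, mul_assoc]

/-! ### Bidiagonal matrices and their commutants -/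

/-- The lower bidiagonal matrix with diagonal entries `θ i` and subdiagonal entries `s i`. -/
def lowerBidiagonal {F : Type*} [Field F] {d : ℕ} (θ : Fin (d + 1) → F) (s : ℕ → F) :
    Matrix (Fin (d + 1)) (Fin (d + 1)) F :=
  Matrix.of fun i j => if i = j then θ i else if (i : ℕ) = (j : ℕ) + 1 then s i else 0

lemma lowerBidiagonal_lowerTriangular {F : Type*} [Field F] {d : ℕ} (θ : Fin (d + 1) → F)
    (s : ℕ → F) (i j : Fin (d + 1)) (hij : i < j) : lowerBidiagonal θ s i j = 0 := by
  have h : ¬ (i : ℕ) = (j : ℕ) + 1 := by have := Fin.lt_def.1 hij; omega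
  simp [lowerBidiagonal, hij.ne, h]

lemma mul_lowerBidiagonal_apply {F : Type*} [Field F] {d : ℕ} (θ : Fin (d + 1) → F)
    (s : ℕ → F) (N : Matrix (Fin (d + 1)) (Fin (d + 1)) F) (i j k : Fin (d + 1))
    (hk : (k : ℕ) = (j : ℕ) + 1) :
    (N * lowerBidiagonal θ s) i j = N i j * θ j + N i k * s k := by
  have hjk : j ≠ k := fun h => by rw [h] at hk; omega
  rw [Matrix.mul_apply, ← Finset.sum_subset (Finset.subset_univ {j, k}),
    Finset.sum_pair hjk]
  · simp [lowerBidiagonal, hjk.symm, hk]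
  · intro l _ hl
    simp only [Finset.mem_insert, Finset.mem_singleton, not_or] at hl
    have : ¬ (l : ℕ) = (j : ℕ) + 1 := fun h => hl.2 (Fin.ext (h.trans hk.symm))
    simp [lowerBidiagonal, hl.1, this]

lemma lowerBidiagonal_mul_apply {F : Type*} [Field F] {d : ℕ} (θ : Fin (d + 1) → F)
    (s : ℕ → F) (N : Matrix (Fin (d + 1)) (Fin (d + 1)) F) (i j k : Fin (d + 1))
    (hk : (i : ℕ) = (k : ℕ) + 1) :
    (lowerBidiagonal θ s * N) i j = θ i * N i j + s i * N k j := by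
  have hik : i ≠ k := fun h => by rw [h] at hk; omega
  rw [Matrix.mul_apply, ← Finset.sum_subset (Finset.subset_univ {i, k}),
    Finset.sum_pair hik]
  · simp [lowerBidiagonal, hik, hk]
  · intro l _ hl
    simp only [Finset.mem_insert, Finset.mem_singleton, not_or] at hl
    have : ¬ (i : ℕ) = (l : ℕ) + 1 := fun h => hl.2 (Fin.ext (by omega))
    simp [lowerBidiagonal, Ne.symm hl.1, this]

/-- The entries of a matrix that commutes with a lower bidiagonal matrix satisfy the recurrence of
divided differences. -/
lemma Commute.lowerBidiagonal_apply {F : Type*} [Field F] {d : ℕ} {θ : Fin (d + 1) → F}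
    {s : ℕ → F} {N : Matrix (Fin (d + 1)) (Fin (d + 1)) F}
    (h : Commute N (lowerBidiagonal θ s)) {i j i' j' : Fin (d + 1)}
    (hi : (i : ℕ) = (i' : ℕ) + 1) (hj : (j' : ℕ) = (j : ℕ) + 1) :
    N i j * θ j + N i j' * s j' = θ i * N i j + s i * N i' j := by
  rw [← mul_lowerBidiagonal_apply θ s N i j j' hj, ← lowerBidiagonal_mul_apply θ s N i j i' hi,
    h.eq]

/-! ### Spectral values of polynomials in `A` -/

lemma IsPrimitiveIdempotents.exists_eigenvector {F V : Type*} [Field F] [AddCommGroup V]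
    [Module F V] {d : ℕ} {A : Module.End F V} {E : Fin (d + 1) → Module.End F V}
    {θ : Fin (d + 1) → F} (hE : IsPrimitiveIdempotents A E) (hθ : IsEigenvalueSequence A E θ) :
    Function.Injective θ ∧
      ∀ i, ∃ x ≠ 0, A x = θ i • x ∧ E i x = x ∧ ∀ j, j ≠ i → E j x = 0 := by
  obtain ⟨η, hη, hdim, -, hproj⟩ := hE
  have key : ∀ i, ∃ x ≠ 0, A x = η i • x ∧ A x = θ i • x ∧ E i x = x ∧
      ∀ j, j ≠ i → E j x = 0 := by
    intro i
    obtain ⟨⟨x, hx⟩, hx0, -⟩ := finrank_eq_one_iff'.1 (hdim i)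
    have hEx : E i x = x := (hproj i).1 x hx
    refine ⟨x, fun h => hx0 (Subtype.ext h), Module.End.mem_eigenspace_iff.1 hx, ?_, hEx,
      fun j hj => (hproj j).2 i hj.symm x hx⟩
    exact Module.End.mem_eigenspace_iff.1 ((hθ i) ▸ LinearMap.mem_range.2 ⟨x, hEx⟩)
  -- The eigenvalues hidden in `IsPrimitiveIdempotents` need not be θ a priori; a common nonzero
  -- eigenvector identifies them.
  have hηθ : θ = η := by
    funext i
    obtain ⟨x, hx0, h1, h2, -⟩ := key i
    exact smul_left_injective F hx0 (h2.symm.trans h1)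
  refine ⟨hηθ ▸ hη, fun i => ?_⟩
  obtain ⟨x, hx0, -, h⟩ := key i
  exact ⟨x, hx0, h⟩

lemma eval_eigenvalue_of_aeval_eq_sum {F V : Type*} [Field F] [AddCommGroup V]
    [Module F V] {d : ℕ} {A : Module.End F V} {E : Fin (d + 1) → Module.End F V}
    {θ : Fin (d + 1) → F} (hE : IsPrimitiveIdempotents A E) (hθ : IsEigenvalueSequence A E θ)
    {f : F} {τ : Fin (d + 1) → F} {P : Polynomial F}
    (hP : Polynomial.aeval A P = f • ∑ i, τ i • E i) (i : Fin (d + 1)) :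
    P.eval (θ i) = f * τ i := by
  obtain ⟨x, hx0, hA, hEi, hEj⟩ := (hE.exists_eigenvector hθ).2 i
  refine smul_left_injective F hx0 ?_
  have h1 : Polynomial.aeval A P x = P.eval (θ i) • x :=
    Module.End.aeval_apply_of_hasEigenvector
      ⟨Module.End.mem_eigenspace_iff.2 hA, hx0⟩
  have h2 : (f • ∑ j, τ j • E j) x = (f * τ i) • x := by
    rw [LinearMap.smul_apply, LinearMap.sum_apply, Finset.sum_eq_single i
      (fun j _ hj => by rw [LinearMap.smul_apply, hEj j hj, smul_zero]) (by simp),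
      LinearMap.smul_apply, hEi, smul_smul]
  exact h1.symm.trans ((congrArg (fun T : Module.End F V => T x) hP).trans h2)

lemma toMatrix_aeval {F V ι : Type*} [Field F] [AddCommGroup V] [Module F V] [Fintype ι]
    [DecidableEq ι] (v : Module.Basis ι F V) (A : Module.End F V) (P : Polynomial F) :
    LinearMap.toMatrix v v (Polynomial.aeval A P) =
      Polynomial.aeval (LinearMap.toMatrix v v A) P := by
  have := Polynomial.aeval_algHom_apply (LinearMap.toMatrixAlgEquiv v) A P
  exact this.symm

/-- Lets the upper bidiagonal `As` be handled by the lower triangular lemmas. -/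
lemma Polynomial.aeval_transpose {F ι : Type*} [Field F] [Fintype ι] [DecidableEq ι]
    (M : Matrix ι ι F) (P : Polynomial F) :
    Polynomial.aeval M.transpose P = (Polynomial.aeval M P).transpose := by
  induction P using Polynomial.induction_on' with
  | add p q hp hq => simp [hp, hq]
  | monomial k a => simp [Polynomial.aeval_monomial, ← Algebra.smul_def, Matrix.transpose_pow]

/-! ### Divided differences at q-Racah nodes -/

lemma qRacahEigenvalue_sub {F : Type*} [Field F] {d : ℕ} {q a : F} (hq : q ≠ 0) (ha : a ≠ 0)
    {i j : Fin (d + 1)} {n : ℕ} (hij : (i : ℕ) = j + n + 1) :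
    qRacahEigenvalue d q a i - qRacahEigenvalue d q a j =
      (q ^ (n + 1) - (q ^ (n + 1))⁻¹) *
        (a * q ^ (2 * (j : ℕ) + 1) / q ^ d * q ^ n -
          (a * q ^ (2 * (j : ℕ) + 1) / q ^ d * q ^ n)⁻¹) := by
  have e1 : (2 * ((i : ℕ) : ℤ) - (d : ℤ)) = ((2 * (j : ℕ) + 2 * n + 2 : ℕ) : ℤ) - (d : ℕ) := by
    rw [hij]; push_cast; ring
  have e2 : ((d : ℤ) - 2 * ((i : ℕ) : ℤ)) = (d : ℕ) - ((2 * (j : ℕ) + 2 * n + 2 : ℕ) : ℤ) := by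
    rw [hij]; push_cast; ring
  have e3 : (2 * ((j : ℕ) : ℤ) - (d : ℤ)) = ((2 * (j : ℕ) : ℕ) : ℤ) - (d : ℕ) := by
    push_cast; ring
  have e4 : ((d : ℤ) - 2 * ((j : ℕ) : ℤ)) = (d : ℕ) - ((2 * (j : ℕ) : ℕ) : ℤ) := by
    push_cast; ring
  unfold qRacahEigenvalue
  rw [e1, e2, e3, e4]
  simp only [zpow_sub₀ hq, zpow_natCast]
  field_simp
  ring

/-- The divided differences of the sequence `T j j` with ratios `-X_j⁻¹`,
`X_j = a q ^ (2 j + 1 - d)`, at the nodes of `q`-Racah type: each is a multiple of the previous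
one. -/
lemma qRacah_dividedDifference_succ {F : Type*} [Field F] {d : ℕ} {q a : F} (hq : q ≠ 0)
    (ha : a ≠ 0) (T : ℕ → ℕ → F) (X : ℕ → F) (hX : ∀ j, X j = a * q ^ (2 * j + 1) / q ^ d)
    (hne : ∀ j n, j + n + 1 ≤ d →
      (q ^ (n + 1) - (q ^ (n + 1))⁻¹) * (X j * q ^ n - (X j * q ^ n)⁻¹) ≠ 0)
    (hrec : ∀ j n, j + n + 1 ≤ d →
      T (j + n + 1) j * ((q ^ (n + 1) - (q ^ (n + 1))⁻¹) * (X j * q ^ n - (X j * q ^ n)⁻¹)) =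
        T (j + n + 1) (j + 1) - T (j + n) j)
    (hdiag : ∀ j, j + 1 ≤ d → T (j + 1) (j + 1) * X j = -T j j) :
    ∀ n j, j + n + 1 ≤ d →
      T (j + n + 1) j * ((q ^ (n + 1) - (q ^ (n + 1))⁻¹) * (1 - X j * q ^ (2 * n))) =
        T (j + n) j * q ^ n := by
  have hX0 : ∀ j, X j ≠ 0 := fun j => by
    rw [hX]; exact div_ne_zero (mul_ne_zero ha (pow_ne_zero _ hq)) (pow_ne_zero _ hq)
  have hXadd : ∀ j n, X (j + n) = X j * q ^ (2 * n) := fun j n => by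
    rw [hX, hX]; ring
  -- Here X_j q^(2n) = X_{j+n}, and X_{j+n} = 1 would make two consecutive nodes coincide.
  have hX1 : ∀ j n, j + n + 1 ≤ d → 1 - X j * q ^ (2 * n) ≠ 0 := by
    intro j n h h0
    have h1 : X (j + n) = 1 := by rw [hXadd]; linear_combination -h0
    refine hne (j + n) 0 (by omega) ?_
    rw [h1]; simp
  -- If moving both indices by one merely rescales T, the recurrence collapses to one term: its
  -- numerator (1 - X) + X (1 - X q^(2n)) equals 1 - (X q^n)², which cancels against the node
  -- difference.
  have of_shift : ∀ n, (∀ j, j + n + 1 ≤ d →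
        T (j + n + 1) (j + 1) * ((1 - X j * q ^ (2 * n)) * X j) = -(T (j + n) j * (1 - X j))) →
      ∀ j, j + n + 1 ≤ d →
        T (j + n + 1) j * ((q ^ (n + 1) - (q ^ (n + 1))⁻¹) * (1 - X j * q ^ (2 * n))) =
          T (j + n) j * q ^ n := by
    intro n hS j hj
    have h1 := hrec j n hj
    have h2 := hS j hj
    have h3 := (mul_ne_zero_iff.1 (hne j n hj)).2
    have hqn : q ^ n ≠ 0 := pow_ne_zero _ hq
    have hinv : X j * q ^ n * (X j * q ^ n)⁻¹ = 1 := mul_inv_cancel₀ (mul_ne_zero (hX0 j) hqn)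
    have e : q ^ (2 * n) = q ^ n * q ^ n := by ring
    rw [e] at h2 ⊢
    refine mul_right_cancel₀ (mul_ne_zero h3 (hX0 j)) ?_
    linear_combination ((1 - X j * (q ^ n * q ^ n)) * X j) * h1 + h2
      + T (j + n) j * hinv
  -- The base case is the ratio of consecutive τ. The induction step compares the one-term relations
  -- at j and j + 1.
  have shift : ∀ n j, j + n + 1 ≤ d →
      T (j + n + 1) (j + 1) * ((1 - X j * q ^ (2 * n)) * X j) = -(T (j + n) j * (1 - X j)) := by
    intro n
    induction n with
    | zero =>
      intro j hj
      have := hdiag j hj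
      simp only [Nat.mul_zero, pow_zero, mul_one, Nat.add_zero]
      linear_combination (1 - X j) * this
    | succ n ih =>
      intro j hj
      have r0 := of_shift n ih j (by omega)
      have r1 := of_shift n ih (j + 1) (by omega)
      have s0 := ih j (by omega)
      have e : X (j + 1) * q ^ (2 * n) = X j * q ^ (2 * (n + 1)) := by rw [hXadd]; ring
      rw [e] at r1
      have hK := mul_ne_zero (mul_ne_zero_iff.1 (hne j n (by omega))).1 (hX1 j n (by omega))
      have i1 : j + 1 + n + 1 = j + (n + 1) + 1 := by ring
      have i2 : j + 1 + n = j + n + 1 := by ring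
      have i3 : j + (n + 1) = j + n + 1 := by ring
      rw [i1, i2] at r1
      rw [i3] at r1 ⊢
      refine mul_right_cancel₀ hK ?_
      linear_combination (X j * (1 - X j * q ^ (2 * n))) * r1 + q ^ n * s0 + (1 - X j) * r0
  exact fun n => of_shift n (shift n)

/-! ### Solving for c -/

lemma eq_or_eq_inv_of_add_inv_eq {F : Type*} [Field F] {a c : F} (ha : a ≠ 0) (hc : c ≠ 0)
    (h : c + c⁻¹ = a + a⁻¹) : c = a ∨ c = a⁻¹ := by
  have : (c - a) * (c - a⁻¹) = 0 := by
    have h1 := mul_inv_cancel₀ ha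
    have h2 := mul_inv_cancel₀ hc
    linear_combination c * h + h1 - h2
  rcases mul_eq_zero.1 this with h | h
  · exact Or.inl (sub_eq_zero.1 h)
  · exact Or.inr (sub_eq_zero.1 h)

lemma add_inv_eq_of_split_relation {F : Type*} [Field F] {m : ℕ} {q a c w t₀ t₁ x φ : F}
    (hq : q ≠ 0) (ha : a ≠ 0) (hc : c ≠ 0)
    (hqm : q ^ (m + 1) - (q ^ (m + 1))⁻¹ ≠ 0) (hq1 : q - q⁻¹ ≠ 0)
    (hY : 1 + a * q ^ m ≠ 0)
    (ht : t₁ ≠ 0) (ht₁ : t₁ * (a * q ^ m) = -t₀) (hw : w ≠ 0)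
    (hφ : φ = qRacahFirstSplit (m + 1) q a a c (m + 1))
    (hx : x * ((q - q⁻¹) * (a * q ^ m - (a * q ^ m)⁻¹)) = φ * (t₁ - t₀))
    (h : (-((q ^ (m + 1) - (q ^ (m + 1))⁻¹) * (a - a⁻¹))) * (t₁ * w) =
      t₀ * (w * ((q ^ (m + 1) - (q ^ (m + 1))⁻¹) * (1 - a * q ^ m)) / q ^ m) + x * w) :
    c + c⁻¹ = a + a⁻¹ := by
  have ht₀ : t₀ = -(t₁ * (a * q ^ m)) := by linear_combination ht₁
  subst ht₀
  have hqm0 : q ^ m ≠ 0 := pow_ne_zero _ hq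
  have hφ' : φ = -(a⁻¹ * a⁻¹) * (q ^ m * q ^ 2) * (q ^ (m + 1) - (q ^ (m + 1))⁻¹) * (q - q⁻¹) *
      ((q ^ (m + 1))⁻¹ - a * a * c * q⁻¹) * ((q ^ (m + 1))⁻¹ - a * a * c⁻¹ * q⁻¹) := by
    rw [hφ]
    unfold qRacahFirstSplit
    have e1 : (((m + 1 : ℕ) : ℤ) - ((m + 1 : ℕ) : ℤ) - 1) = -1 := by ring
    have e2 : (((m + 1 : ℕ) : ℤ) - ((m + 1 : ℕ) : ℤ) + 1) = 1 := by ring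
    rw [e1, e2]
    simp only [zpow_neg, zpow_natCast, zpow_one]
    ring
  generalize q ^ (m + 1) - (q ^ (m + 1))⁻¹ = K at *
  generalize q - q⁻¹ = k at *
  rw [hφ'] at hx
  rw [pow_succ q m] at hx
  generalize q ^ m = p at *
  -- Since t₁ - t₀ = t₁ (1 + a p), the factor 1 + a p cancels from the node difference.
  have hx' : x * (a * p - 1) =
      -(a⁻¹ * a⁻¹) * (p * q ^ 2) * K *
        ((p * q)⁻¹ - a * a * c * q⁻¹) * ((p * q)⁻¹ - a * a * c⁻¹ * q⁻¹) * t₁ * (a * p) := by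
    refine mul_right_cancel₀ (mul_ne_zero hq1 hY) ?_
    have hinv : (a * p) * (a * p)⁻¹ = 1 := mul_inv_cancel₀ (mul_ne_zero ha hqm0)
    linear_combination (a * p) * hx + x * k * hinv
  have h1 : x = -(K * t₁) * (a - a⁻¹ - a * (1 - a * p)) := by
    refine mul_right_cancel₀ hw ?_
    field_simp at h ⊢
    linear_combination -h
  rw [h1] at hx'
  have hKt : -(K * t₁) ≠ 0 := neg_ne_zero.2 (mul_ne_zero hqm ht)
  have h2 : (a - a⁻¹ - a * (1 - a * p)) * (a * p - 1) =
      (a⁻¹ * a⁻¹) * (p * q ^ 2) *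
        ((p * q)⁻¹ - a * a * c * q⁻¹) * ((p * q)⁻¹ - a * a * c⁻¹ * q⁻¹) * (a * p) := by
    refine mul_left_cancel₀ hKt ?_
    linear_combination hx'
  -- After expansion the terms a³p² and a⁻¹ agree on both sides; what remains is a p (c + c⁻¹) = a p
  -- (a + a⁻¹).
  field_simp at h2 ⊢
  have h3 : a * p ≠ 0 := mul_ne_zero ha hqm0
  grind

/-- Apart from nonvanishing, this ratio is all that the argument uses about τ. -/
lemma qRacah_tau_succ {F : Type*} [Field F] {d : ℕ} {q a : F} (hq : q ≠ 0) (ha : a ≠ 0)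
    {τ : Fin (d + 1) → F}
    (hτ : ∀ i : Fin (d + 1),
      τ i = (-1) ^ (i : ℕ) * a ^ (-(i : ℤ)) * q ^ ((i : ℤ) * ((d : ℤ) - (i : ℤ))))
    {i j : Fin (d + 1)} (hij : (i : ℕ) = j + 1) :
    τ i * (a * q ^ (2 * (j : ℕ) + 1) / q ^ d) = -τ j := by
  have e1 : -(((j : ℕ) + 1 : ℕ) : ℤ) = -((j : ℕ) : ℤ) - 1 := by push_cast; ring
  have e2 : ((((j : ℕ) + 1 : ℕ) : ℤ) * ((d : ℤ) - (((j : ℕ) + 1 : ℕ) : ℤ))) =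
      ((j : ℕ) : ℤ) * ((d : ℤ) - ((j : ℕ) : ℤ)) + ((d : ℕ) - ((2 * (j : ℕ) + 1 : ℕ) : ℤ)) := by
    push_cast; ring
  rw [hτ i, hτ j, hij, e1, e2, zpow_sub_one₀ ha, zpow_add₀ hq, zpow_sub₀ hq, zpow_natCast,
    zpow_natCast, pow_succ (-1 : F)]
  field_simp

/-- The bottom left entries of `A * Ws * W = Ws * W * As` for `A`, `Ws` and `As` in split form. -/
lemma bottom_left_entry {F : Type*} [Field F] {m : ℕ} {θ θs : Fin (m + 1 + 1) → F} {s φ : ℕ → F}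
    {N Ns : Matrix (Fin (m + 1 + 1)) (Fin (m + 1 + 1)) F} (hs : s (m + 1) = 1)
    (hNs : ∀ i j, j < i → Ns i j = 0)
    (h : Ns * N * (lowerBidiagonal θs φ).transpose = lowerBidiagonal θ s * Ns * N)
    {l k : Fin (m + 1 + 1)} (hl : (l : ℕ) = m + 1) (hk : (k : ℕ) = m) :
    (θs 0 - θ l) * (Ns l l * N l 0) = Ns k k * N k 0 + Ns k l * N l 0 := by
  have hkl : k < l := Fin.lt_def.2 (by omega)
  -- Column 0 of an upper bidiagonal matrix has only its diagonal entry, so φ enters solely through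
  -- `Ns`.
  have h1 : (Ns * N * (lowerBidiagonal θs φ).transpose) l 0 = (Ns * N) l 0 * θs 0 := by
    rw [Matrix.mul_apply]
    rw [Finset.sum_eq_single 0 (fun x _ hx => ?_) (by simp)]
    · simp [lowerBidiagonal]
    · simp [lowerBidiagonal, Ne.symm hx]
  have h2 := lowerBidiagonal_mul_apply θ s (Ns * N) l 0 k (by omega)
  rw [← Matrix.mul_assoc, ← h, h1, hl, hs] at h2
  have h3 : (Ns * N) l 0 = Ns l l * N l 0 := by
    rw [Matrix.mul_apply]
    refine Finset.sum_eq_single l (fun x _ hx => ?_) (by simp)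
    rw [hNs l x (lt_of_le_of_ne (Fin.le_def.2 (by omega)) hx), zero_mul]
  have h4 : (Ns * N) k 0 = Ns k k * N k 0 + Ns k l * N l 0 := by
    rw [Matrix.mul_apply, ← Finset.sum_subset (Finset.subset_univ {k, l}),
      Finset.sum_pair hkl.ne]
    intro x _ hx
    simp only [Finset.mem_insert, Finset.mem_singleton, not_or] at hx
    have : (x : ℕ) ≠ k := fun e => hx.1 (Fin.ext e)
    have : (x : ℕ) ≠ l := fun e => hx.2 (Fin.ext e)
    rw [hNs k x (Fin.lt_def.2 (by omega)), zero_mul]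
  rw [h3, h4] at h2
  linear_combination h2

lemma Polynomial.commute_aeval_self {F R : Type*} [Field F] [Ring R] [Algebra F R] (x : R)
    (P : Polynomial F) : Commute (Polynomial.aeval x P) x := by
  have h := congrArg (Polynomial.aeval x) (mul_comm P Polynomial.X)
  rwa [map_mul, map_mul, Polynomial.aeval_X] at h

lemma exists_polynomial_of_mem_adjoin {F R : Type*} [Field F] [Ring R] [Algebra F R] {x y : R}
    (h : y ∈ Algebra.adjoin F {x}) : ∃ P : Polynomial F, Polynomial.aeval x P = y := by
  rw [Algebra.adjoin_singleton_eq_range_aeval] at h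
  exact h

/-! ### The lemma -/

theorem lemma6p15 {F V : Type*} [Field F] [AddCommGroup V] [Module F V]
    (d : ℕ) (hd : 1 ≤ d) (q : F) (hq0 : q ≠ 0) (hq4 : q ^ 4 ≠ 1)
    (A : Module.End F V) (E : Fin (d + 1) → Module.End F V)
    (As : Module.End F V) (Es : Fin (d + 1) → Module.End F V)
    (hΦ : IsLeonardSystem A E As Es)
    (a c : F) (hHuang : IsHuangData q A E As Es a a c)
    (τ : Fin (d + 1) → F)
    (hτ : ∀ i : Fin (d + 1),
      τ i = (-1) ^ (i : ℕ) * a ^ (-(i : ℤ)) * q ^ ((i : ℤ) * ((d : ℤ) - (i : ℤ))))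
    (f : F) (hf : f ≠ 0)
    (W Ws : Module.End F V)
    (hW : W = f • ∑ i, τ i • E i) (hWs : Ws = f • ∑ i, τ i • Es i)
    (hBoltzmann : IsBoltzmannPair A As W Ws) :
    c = a ∨ c = a⁻¹ := by
  obtain ⟨ha, -, hc, hpar⟩ := hHuang
  obtain ⟨u, -, -, v, -, hA, hAs⟩ := hpar.firstSplit
  obtain ⟨P, hP⟩ := exists_polynomial_of_mem_adjoin hBoltzmann.mem
  obtain ⟨Ps, hPs⟩ := exists_polynomial_of_mem_adjoin hBoltzmann.dualMem
  have hinj := (hΦ.standard.1.exists_eigenvector hpar.eigenvalues).1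
  have hPθ := eval_eigenvalue_of_aeval_eq_sum hΦ.standard.1 hpar.eigenvalues (hP.trans hW)
  have hPsθ := eval_eigenvalue_of_aeval_eq_sum hΦ.dualStandard.1 hpar.dualEigenvalues
    (hPs.trans hWs)
  have hint := congrArg (LinearMap.toMatrix v v) hBoltzmann.intertwine
  simp only [LinearMap.toMatrix_mul] at hint
  rw [← hP, ← hPs, toMatrix_aeval, toMatrix_aeval] at hint
  set θ := qRacahEigenvalue d q a with hθ
  set φ := qRacahFirstSplit d q a a c with hφ
  have hA' : LinearMap.toMatrix v v A = lowerBidiagonal θ (fun _ => 1) := hA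
  have hAs' : LinearMap.toMatrix v v As = (lowerBidiagonal θ φ).transpose := by
    rw [hAs]
    ext i j
    by_cases hij : i = j
    · simp [lowerBidiagonal, hij]
    · simp [lowerBidiagonal, hij, Ne.symm hij]
  rw [hA', hAs', Polynomial.aeval_transpose] at hint
  obtain ⟨-, hNd⟩ := Matrix.aeval_apply_of_lowerTriangular
    (lowerBidiagonal_lowerTriangular θ (fun _ => (1 : F))) P
  obtain ⟨hLt, hLd⟩ := Matrix.aeval_apply_of_lowerTriangular
    (lowerBidiagonal_lowerTriangular θ φ) Ps
  have hNc : Commute (Polynomial.aeval (lowerBidiagonal θ (fun _ => (1 : F))) P)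
      (lowerBidiagonal θ (fun _ => (1 : F))) :=
    Polynomial.commute_aeval_self _ P
  have hLc : Commute (Polynomial.aeval (lowerBidiagonal θ φ) Ps) (lowerBidiagonal θ φ) :=
    Polynomial.commute_aeval_self _ Ps
  generalize Polynomial.aeval (lowerBidiagonal θ (fun _ => (1 : F))) P = N at *
  generalize Polynomial.aeval (lowerBidiagonal θ φ) Ps = L at *
  have hdiag : ∀ i, N i i = f * τ i := fun i => by
    rw [hNd i, ← hPθ i]; simp [lowerBidiagonal]
  have hLdiag : ∀ i, L i i = f * τ i := fun i => by
    rw [hLd i, ← hPsθ i]; simp [lowerBidiagonal]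
  obtain ⟨m, rfl⟩ : ∃ m, d = m + 1 := ⟨d - 1, by omega⟩
  have hne : ∀ j n, j + n + 1 ≤ m + 1 →
      (q ^ (n + 1) - (q ^ (n + 1))⁻¹) * (a * q ^ (2 * j + 1) / q ^ (m + 1) * q ^ n -
        (a * q ^ (2 * j + 1) / q ^ (m + 1) * q ^ n)⁻¹) ≠ 0 := by
    intro j n h
    have := qRacahEigenvalue_sub hq0 ha (d := m + 1) (i := ⟨j + n + 1, by omega⟩)
      (j := ⟨j, by omega⟩) (n := n) rfl
    rw [← this, sub_ne_zero]
    exact fun e => by have := Fin.mk.inj_iff.1 (hinj e); omega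
  -- Natural-number indices ease the induction; the default 0 is never read.
  let T : ℕ → ℕ → F := fun i j =>
    if h : i < m + 1 + 1 ∧ j < m + 1 + 1 then N ⟨i, h.1⟩ ⟨j, h.2⟩ else 0
  have hT : ∀ i j (hi : i < m + 1 + 1) (hj : j < m + 1 + 1), T i j = N ⟨i, hi⟩ ⟨j, hj⟩ :=
    fun i j hi hj => dif_pos ⟨hi, hj⟩
  have hratio := qRacah_dividedDifference_succ (d := m + 1) hq0 ha T
    (fun j => a * q ^ (2 * j + 1) / q ^ (m + 1)) (fun _ => rfl) hne
    (by
      intro j n h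
      rw [hT _ _ (by omega) (by omega), hT _ _ (by omega) (by omega),
        hT _ _ (by omega) (by omega), ← qRacahEigenvalue_sub hq0 ha (d := m + 1)
        (i := ⟨j + n + 1, by omega⟩) (j := ⟨j, by omega⟩) (n := n) rfl]
      have := hNc.lowerBidiagonal_apply (i := ⟨j + n + 1, by omega⟩) (j := ⟨j, by omega⟩)
        (i' := ⟨j + n, by omega⟩) (j' := ⟨j + 1, by omega⟩) rfl rfl
      linear_combination -this)
    (by
      intro j h
      rw [hT _ _ (by omega) (by omega), hT _ _ (by omega) (by omega), hdiag, hdiag]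
      have := qRacah_tau_succ hq0 ha hτ (i := ⟨j + 1, by omega⟩) (j := ⟨j, by omega⟩) rfl
      linear_combination f * this)
  have hτ0 : ∀ i, τ i ≠ 0 := fun i => by
    rw [hτ i]
    exact mul_ne_zero (mul_ne_zero (pow_ne_zero _ (neg_ne_zero.2 one_ne_zero))
      (zpow_ne_zero _ ha)) (zpow_ne_zero _ hq0)
  -- Needed to divide the corner equation by N_{d,0}.
  have hw : ∀ n, n ≤ m + 1 → T n 0 ≠ 0 := by
    intro n
    induction n with
    | zero => intro _; rw [hT _ _ (by omega) (by omega), hdiag]; exact mul_ne_zero hf (hτ0 _)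
    | succ n ih =>
      intro hn h0
      have := hratio n 0 (by omega)
      rw [Nat.zero_add, h0, zero_mul] at this
      exact mul_ne_zero (ih (by omega)) (pow_ne_zero n hq0) this.symm
  let l : Fin (m + 1 + 1) := ⟨m + 1, by omega⟩
  let k : Fin (m + 1 + 1) := ⟨m, by omega⟩
  have hY : a * q ^ (2 * m + 1) / q ^ (m + 1) = a * q ^ m := by
    field_simp; ring
  have hY0 : a * q ^ 1 / q ^ (m + 1) * q ^ (2 * m) = a * q ^ m := by
    field_simp; ring
  have hY1 : a * q ^ 1 / q ^ (m + 1) * q ^ m = a := by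
    field_simp; ring
  have hnem := hne m 0 (by omega)
  rw [hY] at hnem
  simp only [zero_add, pow_one, pow_zero, mul_one] at hnem
  obtain ⟨hq1, hYinv⟩ := mul_ne_zero_iff.1 hnem
  have entry := bottom_left_entry (s := fun _ => (1 : F)) rfl
    (fun i j hij => hLt j i hij) hint (l := l) (k := k) rfl rfl
  have hLlk := hLc.lowerBidiagonal_apply (i := l) (i' := k) (j := k) (j' := l) rfl rfl
  have hdiff := qRacahEigenvalue_sub hq0 ha (d := m + 1) (i := l) (j := k) (n := 0) rfl
  have hdiff0 := qRacahEigenvalue_sub hq0 ha (d := m + 1) (i := l) (j := 0) (n := m)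
    (by simp [l])
  have hτlk := qRacah_tau_succ hq0 ha hτ (i := l) (j := k) rfl
  have hrm := hratio m 0 (by omega)
  simp only [Nat.zero_add, mul_zero, Fin.val_zero] at hrm hdiff0
  rw [hY0] at hrm
  rw [hY1] at hdiff0
  rw [show ((k : Fin (m + 1 + 1)) : ℕ) = m from rfl, hY] at hdiff hτlk
  simp only [zero_add, pow_one, pow_zero, mul_one] at hdiff
  have hTl : T (m + 1) 0 = N l 0 := hT _ _ (by omega) (by omega)
  have hTk : T m 0 = N k 0 := hT _ _ (by omega) (by omega)
  have hwl : N l 0 ≠ 0 := hTl ▸ hw (m + 1) le_rfl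
  rw [hTl, hTk] at hrm
  have hNk : N k 0 = N l 0 * ((q ^ (m + 1) - (q ^ (m + 1))⁻¹) * (1 - a * q ^ m)) / q ^ m := by
    rw [eq_div_iff (pow_ne_zero m hq0)]; exact hrm.symm
  rw [hLdiag, hLdiag] at entry hLlk
  have hqm := (mul_ne_zero_iff.1 (hne 0 m (by omega))).1
  -- Dividing the last subdiagonal entry of L by f removes the scale common to W and Ws.
  refine eq_or_eq_inv_of_add_inv_eq ha hc
    (add_inv_eq_of_split_relation (m := m) (t₀ := τ k) (t₁ := τ l) (w := N l 0)
      (x := L l k / f) (φ := φ (m + 1)) hq0 ha hc hqm hq1 ?_ (hτ0 l) hτlk hwl rfl ?_ ?_)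
  · intro h
    have : a * q ^ m = -1 := by linear_combination h
    exact hYinv (by rw [this]; simp [inv_neg])
  · rw [← hdiff, div_mul_eq_mul_div, div_eq_iff hf]
    have : φ ((l : Fin (m + 1 + 1)) : ℕ) = φ (m + 1) := rfl
    rw [this] at hLlk
    linear_combination -hLlk
  · rw [← hNk, ← hdiff0]
    refine mul_left_cancel₀ hf ?_
    have : f * (L l k / f) = L l k := mul_div_cancel₀ _ hf
    linear_combination entry - N l 0 * this
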